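/- For a graph $G$ and a set $E'\subseteq E(G)$, call $E'$ a cutset if $G-E'$ (delete the edges in $E'$, keep all vertices) is disconnected, and call a cutset a matching-cut if no two of its edges have a vertex in common. A graph is $P_5$-free if it has no induced path on five vertices. MATCHING-CUT, the problem of deciding whether a given finite simple graph $G$ has a matching-cut, can be solved in polynomial time on $P_5$-free graphs: there are an algorithm (a program for a random access machine with addition and subtraction at unit cost) and a polynomial $p$ such that, for every $P_5$-free graph $G$ on $n$ vertices, given by its adjacency matrix, the algorithm stops after at most $p(n)$ steps and answers correctly whether $G$ has a matching-cut. (A disconnected graph has the empty matching-cut.) Likewise, it can be decided in polynomial time on $P_5$-free graphs, connected or not, whether some connected component of $G$ has a matching-cut; for connected $G$ the two questions are the same. -/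

import Mathlib

/-! ### Matching-cuts -/

namespace MatchingCut

/-- `E'` is a cutset of `G`: a set of edges of `G` such that `G - E'` is disconnected,
i.e. some two vertices are not joined by a walk in `G - E'`. -/
def IsCutset {V : Type*} (G : SimpleGraph V) (E' : Set (Sym2 V)) : Prop :=
  E' ⊆ G.edgeSet ∧ ¬ (G.deleteEdges E').Preconnected

/-- No two distinct edges of `E'` have a vertex in common. -/
def IsMatchingSet {V : Type*} (E' : Set (Sym2 V)) : Prop :=
  ∀ e ∈ E', ∀ f ∈ E', e ≠ f → ∀ v, v ∈ e → v ∉ f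

/-- A matching-cut is a cutset that is a matching. -/
def IsMatchingCut {V : Type*} (G : SimpleGraph V) (E' : Set (Sym2 V)) : Prop :=
  IsCutset G E' ∧ IsMatchingSet E'

/-- `G` has a matching-cut. A disconnected graph has one, namely `∅`. -/
def HasMatchingCut {V : Type*} (G : SimpleGraph V) : Prop :=
  ∃ E' : Set (Sym2 V), IsMatchingCut G E'

/-- Some connected component of `G` has a matching-cut. For connected `G` this says the same as
`HasMatchingCut G`. -/
def SomeComponentHasMatchingCut {V : Type*} (G : SimpleGraph V) : Prop :=
  ∃ c : G.ConnectedComponent, HasMatchingCut c.toSimpleGraph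

/-- `G` has no induced path on `t` vertices. -/
def PathFree (t : ℕ) {V : Type*} (G : SimpleGraph V) : Prop :=
  ¬ (SimpleGraph.pathGraph t).IsIndContained G

end MatchingCut

/-! ### Random access machines

The machine has registers `R[0], R[1], R[2], …` that hold natural numbers, a read-only input list
that is read from left to right, and a program, which is a finite list of instructions. The
arithmetic is addition and truncated subtraction only, so that in `t` steps a register gets
at most `O(t)` bits longer than the numbers in the input and in the program; running times on this
machine (every instruction costs one step) and on Turing machines are polynomially related. -/

namespace RAM

/-- The instructions of the machine. -/
inductive Instr : Type
  /-- `R[i] := c` -/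
  | const (i c : ℕ)
  /-- `R[i] := R[j] + R[k]` -/
  | add (i j k : ℕ)
  /-- `R[i] := R[j] - R[k]` (and `0` if `R[j] < R[k]`) -/
  | sub (i j k : ℕ)
  /-- `R[i] := R[R[j]]` -/
  | load (i j : ℕ)
  /-- `R[R[i]] := R[j]` -/
  | store (i j : ℕ)
  /-- `R[i] :=` the next number of the input (`0` at the end of the input) -/
  | read (i : ℕ)
  /-- go to instruction number `l` -/
  | jump (l : ℕ)
  /-- if `R[i] = 0`, go to instruction number `l` -/
  | jumpIfZero (i l : ℕ)

/-- A program is a finite list of instructions, numbered from `0`. -/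
abbrev Program : Type := List Instr

/-- A configuration: the number of the next instruction, the registers, the unread input. -/
structure Config : Type where
  pc : ℕ
  reg : ℕ → ℕ
  input : List ℕ

/-- The effect of one instruction. -/
def Instr.exec : Instr → Config → Config
  | .const i c, s => ⟨s.pc + 1, Function.update s.reg i c, s.input⟩
  | .add i j k, s => ⟨s.pc + 1, Function.update s.reg i (s.reg j + s.reg k), s.input⟩
  | .sub i j k, s => ⟨s.pc + 1, Function.update s.reg i (s.reg j - s.reg k), s.input⟩
  | .load i j, s => ⟨s.pc + 1, Function.update s.reg i (s.reg (s.reg j)), s.input⟩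
  | .store i j, s => ⟨s.pc + 1, Function.update s.reg (s.reg i) (s.reg j), s.input⟩
  | .read i, s => ⟨s.pc + 1, Function.update s.reg i (s.input.headD 0), s.input.tail⟩
  | .jump l, s => ⟨l, s.reg, s.input⟩
  | .jumpIfZero i l, s => ⟨if s.reg i = 0 then l else s.pc + 1, s.reg, s.input⟩

/-- One step of the program `P`; `none` if the machine has halted, which it does when there is no
instruction with the current number. -/
def step (P : Program) (s : Config) : Option Config :=
  (P[s.pc]?).map fun I => I.exec s

/-- `t` steps of the program `P`; `none` if the machine halts earlier. -/
def steps (P : Program) : ℕ → Config → Option Config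
  | 0, s => some s
  | t + 1, s => (step P s).bind (steps P t)

/-- The start: instruction number `0`, all registers `0`, the whole input unread. -/
def start (x : List ℕ) : Config := ⟨0, fun _ => 0, x⟩

/-- On input `x` the program `P` halts after at most `T` steps, with the truth value of `q`
(`1` for true, `0` for false) in register `0`. -/
def AnswersWithin (P : Program) (x : List ℕ) (q : Prop) (T : ℕ) : Prop :=
  ∃ t ≤ T, ∃ s : Config, steps P t (start x) = some s ∧ step P s = none ∧
    (q → s.reg 0 = 1) ∧ (¬ q → s.reg 0 = 0)

open Classical in
/-- The input that describes a graph on the vertices `0, …, n - 1`: the number `n`, followed by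
the rows of the adjacency matrix. -/
noncomputable def encodeGraph {n : ℕ} (G : SimpleGraph (Fin n)) : List ℕ :=
  n :: (List.finRange n).flatMap fun u =>
    (List.finRange n).map fun v => if G.Adj u v then 1 else 0

/-- The decision problem `Q` on graphs is solvable in polynomial time on the graphs in the
class `C`: one program answers correctly on all graphs in `C`, in a number of steps
that is bounded by a polynomial in the number of vertices. -/
def PolyTimeSolvableOn (C Q : ∀ {n : ℕ}, SimpleGraph (Fin n) → Prop) : Prop :=
  ∃ (P : Program) (p : Polynomial ℕ), ∀ (n : ℕ) (G : SimpleGraph (Fin n)),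
    C G → AnswersWithin P (encodeGraph G) (Q G) (p.eval n)

end RAM

/-! A matching-cut amounts to a vertex set S, neither empty nor everything, such that every vertex
has at most one neighbour across S (`hasMatchingCut_iff_exists_side`). Suppose an edge ab crosses S,
with b in S; only the component of ab matters then. If a or b is a leaf, that leaf alone is a side.
Otherwise P₅-freeness yields p and q such that the closed neighbourhoods of a, b, p, q cover the
component (`PathFree.exists_dominating`). All neighbours of a vertex but at most one lie on its own
side, so three vertices describe S near any given vertex (`IsMatchingSide.exists_ballSet`); near a,
it is just b. Hence S can be replaced by a union of three balls with nine parameters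
(`PathFree.exists_threeBalls`), and the existence of a crossed side becomes a fixed first-order
sentence. Connectedness is first-order too, since shortest paths in a P₅-free graph have at most
three edges (`PathFree.preconnected_iff`).

A fixed first-order sentence is decided in polynomial time by trying all values of its variables:
`Formula.compile` turns quantifiers into nested loops, and `polyTimeSolvableOn_of_formula` adds the
code that stores the matrix. -/

/-! ### First-order formulas over graphs -/

namespace RAM

/-- First-order formulas in the language of graphs whose free variables are `0, …, k - 1`.
A quantifier binds the variable `k`. -/
inductive Formula : ℕ → Type
  | adj {k : ℕ} (i j : Fin k) : Formula k
  | eq {k : ℕ} (i j : Fin k) : Formula k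
  | neg {k : ℕ} (φ : Formula k) : Formula k
  | and {k : ℕ} (φ ψ : Formula k) : Formula k
  | all {k : ℕ} (φ : Formula (k + 1)) : Formula k

namespace Formula

/-- Truth of a formula in a graph. -/
def Sat {V : Type*} (G : SimpleGraph V) : ∀ {k : ℕ}, Formula k → (Fin k → V) → Prop
  | _, adj i j, e => G.Adj (e i) (e j)
  | _, eq i j, e => e i = e j
  | _, neg φ, e => ¬ φ.Sat G e
  | _, and φ ψ, e => φ.Sat G e ∧ ψ.Sat G e
  | k, all φ, e => ∀ v, φ.Sat G (Fin.snoc (α := fun _ : Fin (k + 1) => V) e v)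

/-- The nesting depth of quantifiers. -/
def depth : ∀ {k : ℕ}, Formula k → ℕ
  | _, adj _ _ => 0
  | _, eq _ _ => 0
  | _, neg φ => φ.depth
  | _, and φ ψ => max φ.depth ψ.depth
  | _, all φ => φ.depth + 1

/-- The length of the compiled formula. -/
def codeLength : ∀ {k : ℕ}, Formula k → ℕ
  | _, adj _ _ => 2
  | _, eq _ _ => 4
  | _, neg φ => φ.codeLength + 1
  | _, and φ ψ => φ.codeLength + (1 + ψ.codeLength)
  | _, all φ => 4 + (φ.codeLength + 5)

/-- The code that evaluates a formula, placed at instruction number `l`, with the adjacency matrix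
stored from register `B` on. Register `1` holds the constant `1`, register `2` the number `n` of
vertices, and the registers `7 + 2 * i` and `8 + 2 * i` hold the value `v` of the variable `i` and
the address `B + n * v` of its row. The truth value is left in register `0`. -/
def compile (B : ℕ) : ∀ {k : ℕ}, ℕ → Formula k → List Instr
  | _, _, adj i j => [.add 0 (8 + 2 * i) (7 + 2 * j), .load 0 0]
  | _, _, eq i j =>
    [.sub 0 (7 + 2 * i) (7 + 2 * j), .sub 3 (7 + 2 * j) (7 + 2 * i), .add 0 0 3, .sub 0 1 0]
  | _, l, neg φ => φ.compile B l ++ [.sub 0 1 0]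
  | _, l, and φ ψ => φ.compile B l ++
      (.jumpIfZero 0 (l + (φ.codeLength + (1 + ψ.codeLength))) ::
        ψ.compile B (l + φ.codeLength + 1))
  | k, l, all φ =>
    [.const (7 + 2 * k) 0, .const (8 + 2 * k) B, .sub 0 2 (7 + 2 * k),
      .jumpIfZero 0 (l + 4 + φ.codeLength + 4)] ++
    (φ.compile B (l + 4) ++
    [.jumpIfZero 0 (l + (4 + (φ.codeLength + 5))), .add (7 + 2 * k) (7 + 2 * k) 1,
      .add (8 + 2 * k) (8 + 2 * k) 2, .jump (l + 2), .const 0 1])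

theorem length_compile (B : ℕ) {k : ℕ} (φ : Formula k) (l : ℕ) :
    (φ.compile B l).length = φ.codeLength := by
  induction φ generalizing l <;> simp_all [compile, codeLength] <;> omega

/-- A bound for the running time of the compiled formula. -/
noncomputable def time : ∀ {k : ℕ}, Formula k → Polynomial ℕ
  | _, adj _ _ => 2
  | _, eq _ _ => 4
  | _, neg φ => φ.time + 1
  | _, and φ ψ => φ.time + 1 + ψ.time
  | _, all φ => .X * (φ.time + 6) + 5

end Formula

/-! ### Running code -/

/-- The instructions `C` stand in `P` from instruction number `l` on. -/
def CodeAt (P : Program) (l : ℕ) (C : List Instr) : Prop :=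
  ∀ k < C.length, P[l + k]? = C[k]?

theorem codeAt_nil (P : Program) (l : ℕ) : CodeAt P l [] := by
  intro k hk; simp at hk

theorem codeAt_cons {P : Program} {l : ℕ} {I : Instr} {C : List Instr} :
    CodeAt P l (I :: C) ↔ P[l]? = some I ∧ CodeAt P (l + 1) C := by
  constructor
  · intro h
    refine ⟨by simpa using h 0 (by simp), fun k hk => ?_⟩
    have := h (k + 1) (by simpa using hk)
    rw [show l + 1 + k = l + (k + 1) by omega, this]
    simp
  · rintro ⟨h0, h⟩ k hk
    cases k with
    | zero => simpa using h0
    | succ k =>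
      have := h k (by simpa using hk)
      rw [show l + (k + 1) = l + 1 + k by omega, this]
      simp

theorem codeAt_append {P : Program} {l : ℕ} {C D : List Instr} :
    CodeAt P l (C ++ D) ↔ CodeAt P l C ∧ CodeAt P (l + C.length) D := by
  induction C generalizing l with
  | nil => simp [codeAt_nil]
  | cons I C ih =>
    rw [List.cons_append, codeAt_cons, codeAt_cons, ih, and_assoc, List.length_cons,
      show l + (C.length + 1) = l + 1 + C.length by omega]

theorem codeAt_self (C D : List Instr) : CodeAt (C ++ D) 0 C := by
  intro k hk
  rw [Nat.zero_add, List.getElem?_append_left hk]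

theorem steps_trans {P : Program} {t t' : ℕ} {s s' s'' : Config}
    (h : steps P t s = some s') (h' : steps P t' s' = some s'') :
    steps P (t + t') s = some s'' := by
  induction t generalizing s with
  | zero => simp only [steps, Option.some.injEq] at h; subst h; simpa using h'
  | succ t ih =>
    rw [Nat.add_right_comm]
    simp only [steps] at h ⊢
    cases hs : step P s with
    | none => simp [hs] at h
    | some u =>
      rw [hs] at h
      exact ih h

theorem steps_one {P : Program} {l : ℕ} {I : Instr} {r : ℕ → ℕ} {x : List ℕ}
    (h : P[l]? = some I) : steps P 1 ⟨l, r, x⟩ = some (I.exec ⟨l, r, x⟩) := by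
  simp [steps, step, h]

theorem steps_cons {P : Program} {l : ℕ} {I : Instr} {r : ℕ → ℕ} {x : List ℕ} {t : ℕ}
    {s : Config} (h : P[l]? = some I) (h' : steps P t (I.exec ⟨l, r, x⟩) = some s) :
    steps P (t + 1) ⟨l, r, x⟩ = some s := by
  simp only [steps, step, h]
  exact h'

/-! ### Correctness and running time of compiled formulas -/

/-- The registers hold the adjacency matrix of `G` from `B` on, and the values `e` of the
variables. -/
structure Represents {n : ℕ} (G : SimpleGraph (Fin n)) (B k : ℕ) (e : Fin k → Fin n)
    (r : ℕ → ℕ) : Prop where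
  one : r 1 = 1
  size : r 2 = n
  var : ∀ i : Fin k, r (7 + 2 * i) = e i
  row : ∀ i : Fin k, r (8 + 2 * i) = B + n * e i
  adj : ∀ u v : Fin n, G.Adj u v → r (B + n * u + v) = 1
  notAdj : ∀ u v : Fin n, ¬ G.Adj u v → r (B + n * u + v) = 0

namespace Represents

variable {n : ℕ} {G : SimpleGraph (Fin n)} {B k : ℕ} {e : Fin k → Fin n} {r : ℕ → ℕ}

/-- Compiled code writes only to scratch registers below 7 and to registers of variables not yet
bound; both are harmless as long as they lie below the matrix. -/
theorem update (h : Represents G B k e r) {i : ℕ} (c : ℕ) (hB : i < B) (h1 : i ≠ 1) (h2 : i ≠ 2)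
    (h3 : i < 7 ∨ 7 + 2 * k ≤ i) : Represents G B k e (Function.update r i c) where
  one := by rw [Function.update_of_ne (Ne.symm h1)]; exact h.one
  size := by rw [Function.update_of_ne (Ne.symm h2)]; exact h.size
  var j := by rw [Function.update_of_ne (by omega)]; exact h.var j
  row j := by rw [Function.update_of_ne (by omega)]; exact h.row j
  adj u v huv := by
    rw [Function.update_of_ne (by rw [add_assoc]; omega)]; exact h.adj u v huv
  notAdj u v huv := by
    rw [Function.update_of_ne (by rw [add_assoc]; omega)]; exact h.notAdj u v huv

theorem snoc (h : Represents G B k e r) (v : Fin n) (hv : r (7 + 2 * k) = v)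
    (hr : r (8 + 2 * k) = B + n * v) :
    Represents G B (k + 1) (Fin.snoc (α := fun _ : Fin (k + 1) => Fin n) e v) r where
  one := h.one
  size := h.size
  var i := by
    induction i using Fin.lastCases with
    | last => simpa using hv
    | cast i => simpa using h.var i
  row i := by
    induction i using Fin.lastCases with
    | last => simpa using hr
    | cast i => simpa using h.row i
  adj := h.adj
  notAdj := h.notAdj

theorem of_snoc {v : Fin n}
    (h : Represents G B (k + 1) (Fin.snoc (α := fun _ : Fin (k + 1) => Fin n) e v) r) :
    Represents G B k e r ∧ r (7 + 2 * k) = v ∧ r (8 + 2 * k) = B + n * v := by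
  refine ⟨⟨h.one, h.size, fun i => ?_, fun i => ?_, h.adj, h.notAdj⟩, ?_, ?_⟩
  · simpa using h.var i.castSucc
  · simpa using h.row i.castSucc
  · simpa using h.var (Fin.last k)
  · simpa using h.row (Fin.last k)

end Represents

open Classical in
/-- From instruction `l` and the registers `r`, the program reaches instruction `l'` in at most `T`
steps, with the truth value of `q` in register `0`, and still represents `G` and `e`. -/
def Evaluates (P : Program) {n : ℕ} (G : SimpleGraph (Fin n)) (B k : ℕ) (e : Fin k → Fin n)
    (l l' : ℕ) (r : ℕ → ℕ) (q : Prop) (T : ℕ) : Prop :=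
  ∀ x, ∃ t ≤ T, ∃ r' : ℕ → ℕ, steps P t ⟨l, r, x⟩ = some ⟨l', r', x⟩ ∧
    Represents G B k e r' ∧ r' 0 = if q then 1 else 0

/-- The loop invariant: c is the current value of the bound variable and d values remain, so the
loop decides the statement for all v ≥ c. A round costs the body and six instructions; the exit with
answer 1 costs three. -/
theorem all_loop {P : Program} {n : ℕ} {G : SimpleGraph (Fin n)} {B k : ℕ} {e : Fin k → Fin n}
    {l m T : ℕ} {Q : Fin n → Prop} (hB : 9 + 2 * k ≤ B)
    (h2 : P[l + 2]? = some (.sub 0 2 (7 + 2 * k)))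
    (h3 : P[l + 3]? = some (.jumpIfZero 0 (l + 4 + m + 4)))
    (h4 : P[l + 4 + m]? = some (.jumpIfZero 0 (l + (4 + (m + 5)))))
    (h5 : P[l + 4 + m + 1]? = some (.add (7 + 2 * k) (7 + 2 * k) 1))
    (h6 : P[l + 4 + m + 2]? = some (.add (8 + 2 * k) (8 + 2 * k) 2))
    (h7 : P[l + 4 + m + 3]? = some (.jump (l + 2)))
    (h8 : P[l + 4 + m + 4]? = some (.const 0 1))
    (body : ∀ v r, Represents G B (k + 1) (Fin.snoc (α := fun _ : Fin (k + 1) => Fin n) e v) r →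
      Evaluates P G B (k + 1) (Fin.snoc (α := fun _ : Fin (k + 1) => Fin n) e v)
        (l + 4) (l + 4 + m) r (Q v) T)
    (d c : ℕ) (hc : c + d = n) (r : ℕ → ℕ) (hr : Represents G B k e r)
    (hv : r (7 + 2 * k) = c) (hrow : r (8 + 2 * k) = B + n * c) :
    Evaluates P G B k e (l + 2) (l + (4 + (m + 5))) r (∀ v : Fin n, c ≤ v → Q v)
      (d * (T + 6) + 3) := by
  induction d generalizing c r with
  | zero =>
    intro x
    refine ⟨3, by omega, Function.update (Function.update r 0 0) 0 1, ?_,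
      (hr.update 0 (by omega) (by omega) (by omega) (by omega)).update 1 (by omega) (by omega)
        (by omega) (by omega), ?_⟩
    · refine steps_cons h2 (steps_cons (by simpa [Instr.exec] using h3) ?_)
      have hz : r 2 - r (7 + 2 * k) = 0 := by rw [hr.size, hv]; omega
      simp only [Instr.exec, hz, Function.update_self, if_true]
      rw [steps_one h8]
      simp only [Instr.exec, Option.some.injEq, Config.mk.injEq, and_true]
      omega
    · rw [if_pos (fun v hcv => absurd v.2 (by omega))]
      simp
  | succ d ih =>
    intro x
    have hcn : c < n := by omega
    have hsub : r 2 - r (7 + 2 * k) = d + 1 := by rw [hr.size, hv]; omega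
    have hr1 := hr.update (i := 0) (d + 1) (by omega) (by omega) (by omega) (by omega)
    have hr2 := hr1.snoc ⟨c, hcn⟩ (by rw [Function.update_of_ne (by omega)]; exact hv)
      (by rw [Function.update_of_ne (by omega)]; exact hrow)
    obtain ⟨t, ht, r', hst, hrep, hres⟩ := body ⟨c, hcn⟩ _ hr2 x
    obtain ⟨hrep', hv', hrow'⟩ := hrep.of_snoc
    have hstart : steps P (t + 1 + 1) ⟨l + 2, r, x⟩ = some ⟨l + 4 + m, r', x⟩ := by
      refine steps_cons h2 (steps_cons (by simpa [Instr.exec] using h3) ?_)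
      simpa [Instr.exec, hsub] using hst
    by_cases hq : Q ⟨c, hcn⟩
    · rw [if_pos hq] at hres
      have hr3 := (hrep'.update (i := 7 + 2 * k) (c + 1) (by omega) (by omega) (by omega)
        (by omega)).update (i := 8 + 2 * k) (B + n * c + n) (by omega) (by omega) (by omega)
        (by omega)
      obtain ⟨t', ht', r'', hst', hrep'', hres''⟩ := ih (c + 1) (by omega) _ hr3
        (by rw [Function.update_of_ne (by omega), Function.update_self])
        (by rw [Function.update_self]; ring) x
      refine ⟨t + 1 + 1 + (t' + 1 + 1 + 1 + 1), ?_, r'', ?_, hrep'', ?_⟩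
      · rw [Nat.succ_mul]; omega
      · refine steps_trans hstart (steps_cons h4 ?_)
        simp only [Instr.exec, hres, one_ne_zero, if_false]
        refine steps_cons h5 (steps_cons h6 (steps_cons h7 ?_))
        simp only [Instr.exec]
        rw [hrep'.one, hv', Function.update_of_ne (show 8 + 2 * k ≠ 7 + 2 * k by omega),
          Function.update_of_ne (show 2 ≠ 7 + 2 * k by omega), hrep'.size, hrow']
        exact hst'
      · rw [hres'']
        congr 1
        refine propext ⟨fun h v hcv => ?_, fun h v hcv => h v (by omega)⟩
        rcases Nat.eq_or_lt_of_le hcv with hcv | hcv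
        · have : v = ⟨c, hcn⟩ := Fin.ext hcv.symm
          rwa [this]
        · exact h v hcv
    · rw [if_neg hq] at hres
      refine ⟨t + 1 + 1 + 1, ?_, r', ?_, hrep', ?_⟩
      · rw [Nat.succ_mul]; omega
      · refine steps_trans hstart ?_
        rw [steps_one h4]
        simp [Instr.exec, hres]
      · rw [hres, if_neg (fun h => hq (h ⟨c, hcn⟩ le_rfl))]

/-- Induction on the formula. The bound on B reserves two registers for every variable that is free
or can be bound inside, so no loop overwrites the matrix. -/
theorem Formula.evaluates_compile {P : Program} {n : ℕ} {G : SimpleGraph (Fin n)} {B k : ℕ}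
    (φ : Formula k) (e : Fin k → Fin n) (l : ℕ) (hP : CodeAt P l (φ.compile B l))
    (hB : 7 + 2 * (k + φ.depth) ≤ B) (r : ℕ → ℕ) (hr : Represents G B k e r) :
    Evaluates P G B k e l (l + φ.codeLength) r (φ.Sat G e) (φ.time.eval n) := by
  induction φ generalizing l r with
  | adj i j =>
    intro x
    simp only [compile, codeAt_cons] at hP
    refine ⟨2, by simp [time], _, steps_cons hP.1 (steps_one hP.2.1), ?_, ?_⟩
    · exact (hr.update _ (by omega) (by omega) (by omega) (by omega)).update _ (by omega)
        (by omega) (by omega) (by omega)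
    · simp only [Function.update_self, hr.row, hr.var]
      rw [Function.update_of_ne (by omega)]
      by_cases h : G.Adj (e i) (e j)
      · exact (hr.adj _ _ h).trans (if_pos h).symm
      · exact (hr.notAdj _ _ h).trans (if_neg h).symm
  | eq i j =>
    intro x
    simp only [compile, codeAt_cons] at hP
    obtain ⟨h0, h1, h2, h3, -⟩ := hP
    refine ⟨4, by simp [time], _, steps_cons h0 (steps_cons h1 (steps_cons h2 (steps_one h3))),
      ?_, ?_⟩
    · exact (((hr.update _ (by omega) (by omega) (by omega) (by omega)).update _ (by omega)
        (by omega) (by omega) (by omega)).update _ (by omega) (by omega) (by omega)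
        (by omega)).update _ (by omega) (by omega) (by omega) (by omega)
    -- One of the two truncated differences is 0, so their sum is the distance of the values, and 1
    -- minus it is 1 exactly when they agree.
    · have hi := hr.var i
      have hj := hr.var j
      have h1 := hr.one
      simp [Sat, hi, hj, h1, Fin.ext_iff]
      split_ifs <;> omega
  | neg φ ih =>
    intro x
    simp only [compile, codeAt_append, codeAt_cons, length_compile] at hP
    obtain ⟨t, ht, r', hst, hrep, hres⟩ := ih e l hP.1 hB r hr x
    refine ⟨t + 1, by simpa [time] using ht, _, steps_trans hst (steps_one hP.2.1), ?_, ?_⟩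
    · exact hrep.update _ (by omega) (by omega) (by omega) (by omega)
    · simp only [Function.update_self, hrep.one, hres, Sat]
      split_ifs <;> simp_all
  | and φ ψ ih ih' =>
    intro x
    simp only [compile, codeAt_append, codeAt_cons, length_compile] at hP
    simp only [depth] at hB
    obtain ⟨t, ht, r', hst, hrep, hres⟩ := ih e l hP.1 (by omega) r hr x
    have htime : ((Formula.and φ ψ).time).eval n = φ.time.eval n + 1 + ψ.time.eval n := by
      simp [time]
    by_cases hφ : φ.Sat G e
    · rw [if_pos hφ] at hres
      obtain ⟨t', ht', r'', hst', hrep', hres'⟩ := ih' e _ hP.2.2 (by omega) r' hrep x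
      refine ⟨t + (t' + 1), by omega, r'', steps_trans hst (steps_cons hP.2.1 ?_), hrep', ?_⟩
      · simp only [Instr.exec, hres, one_ne_zero, if_false, codeLength]
        rw [hst']
        simp only [Option.some.injEq, Config.mk.injEq, and_true]
        omega
      · rw [hres']
        congr 1
        simp [Sat, hφ]
    · rw [if_neg hφ] at hres
      refine ⟨t + 1, by omega, r', steps_trans hst ?_, hrep, ?_⟩
      · rw [steps_one hP.2.1]
        simp [Instr.exec, hres, codeLength]
      · rw [hres]
        exact (if_neg (c := φ.Sat G e ∧ ψ.Sat G e) fun h => hφ h.1).symm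
  | @all k φ ih =>
    intro x
    simp only [compile, codeAt_append, codeAt_cons, length_compile, List.length_cons,
      List.length_nil, Nat.zero_add, Nat.reduceAdd, add_assoc] at hP
    simp only [depth] at hB
    obtain ⟨⟨h0, h1, h2, h3, -⟩, hφ, h4, h5, h6, h7, h8, -⟩ := hP
    have hr2 := (hr.update (i := 7 + 2 * k) 0 (by omega) (by omega) (by omega)
      (by omega)).update (i := 8 + 2 * k) B (by omega) (by omega) (by omega) (by omega)
    obtain ⟨t, ht, r', hst, hrep, hres⟩ := all_loop (T := φ.time.eval n) (m := φ.codeLength)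
      (Q := fun v => φ.Sat G (Fin.snoc (α := fun _ : Fin (k + 1) => Fin n) e v)) (l := l)
      (by omega) h2
      (by simpa only [add_assoc] using h3) (by simpa only [add_assoc] using h4)
      (by simpa only [add_assoc] using h5) (by simpa only [add_assoc] using h6)
      (by simpa only [add_assoc] using h7) (by simpa only [add_assoc] using h8)
      (fun v r hr => ih _ _ hφ (by omega) r hr) n 0 (by omega) _ hr2
      (by rw [Function.update_of_ne (by omega), Function.update_self])
      (by rw [Function.update_self]; simp) x
    refine ⟨t + 1 + 1, ?_, r', steps_cons h0 (steps_cons h1 hst), hrep, ?_⟩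
    · simp only [time, Polynomial.eval_add, Polynomial.eval_mul, Polynomial.eval_X,
        Polynomial.eval_ofNat]
      omega
    · rw [hres]
      congr 1
      simp [Sat]

end RAM

namespace RAM

/-! ### Loading the graph -/

/-- The code that stores the adjacency matrix from register `B` on and sets the registers `1` and
`2`. If the graph has no vertices, it jumps to the instruction number `l`. -/
def loadCode (B l : ℕ) : List Instr :=
  [.read 2, .jumpIfZero 2 l, .const 1 1, .const 3 B, .add 4 2 0,
    .add 5 5 2, .sub 4 4 1, .jumpIfZero 4 9, .jump 5,
    .jumpIfZero 5 15, .read 6, .store 3 6, .add 3 3 1, .sub 5 5 1, .jump 9]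

/-- Multiplication is not an instruction, so the number n * n of matrix entries is found by repeated
addition. The counter is tested after its decrement, hence starts at d + 1. -/
theorem multiply_loop {P : Program} (h5 : P[5]? = some (.add 5 5 2))
    (h6 : P[6]? = some (.sub 4 4 1)) (h7 : P[7]? = some (.jumpIfZero 4 9))
    (h8 : P[8]? = some (.jump 5)) (x : List ℕ) (n d : ℕ) (r : ℕ → ℕ) (hr1 : r 1 = 1)
    (hr2 : r 2 = n) (hr4 : r 4 = d + 1) :
    ∃ t ≤ 4 * (d + 1), ∃ r' : ℕ → ℕ, steps P t ⟨5, r, x⟩ = some ⟨9, r', x⟩ ∧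
      r' 1 = 1 ∧ r' 2 = n ∧ r' 3 = r 3 ∧ r' 5 = r 5 + (d + 1) * n := by
  induction d generalizing r with
  | zero =>
    refine ⟨3, by omega, _, steps_cons h5 (steps_cons h6 ((steps_one h7).trans
      (congrArg some (Config.mk.injEq .. |>.mpr ⟨?_, rfl, rfl⟩)))), ?_⟩
    · simp [hr1, hr4]
    · simp [hr1, hr2]
  | succ d ih =>
    obtain ⟨t, ht, r', hst, h⟩ := ih
      (Function.update (Function.update r 5 (r 5 + n)) 4 (d + 1))
      (by simp [hr1]) (by simp [hr2]) (by simp)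
    refine ⟨t + 1 + 1 + 1 + 1, by omega, r',
      steps_cons h5 (steps_cons h6 (steps_cons h7 ?_)), ?_⟩
    · simp only [Instr.exec]
      rw [if_neg (by simp [hr1, hr4])]
      refine steps_cons h8 ?_
      simpa [Instr.exec, hr1, hr2, hr4] using hst
    · refine ⟨h.1, h.2.1, by simpa using h.2.2.1, ?_⟩
      rw [h.2.2.2]
      simp
      ring

/-- Register 3 is the write address and register 5 the number of entries left. Cells below the write
address stay unchanged, which the induction needs to keep the entries already copied. -/
theorem copy_loop {P : Program} (h9 : P[9]? = some (.jumpIfZero 5 15))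
    (h10 : P[10]? = some (.read 6)) (h11 : P[11]? = some (.store 3 6))
    (h12 : P[12]? = some (.add 3 3 1)) (h13 : P[13]? = some (.sub 5 5 1))
    (h14 : P[14]? = some (.jump 9)) (n : ℕ) (x : List ℕ) (r : ℕ → ℕ) (hr1 : r 1 = 1)
    (hr2 : r 2 = n) (hr3 : 7 ≤ r 3) (hr5 : r 5 = x.length) :
    ∃ t ≤ 6 * x.length + 1, ∃ r' : ℕ → ℕ, steps P t ⟨9, r, x⟩ = some ⟨15, r', []⟩ ∧
      r' 1 = 1 ∧ r' 2 = n ∧ (∀ i, 7 ≤ i → i < r 3 → r' i = r i) ∧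
      ∀ i (hi : i < x.length), r' (r 3 + i) = x[i] := by
  induction x generalizing r with
  | nil =>
    refine ⟨1, by simp, r, ?_, hr1, hr2, fun _ _ _ => rfl, by simp⟩
    rw [steps_one h9]
    simp [Instr.exec, hr5]
  | cons a x ih =>
    rw [List.length_cons] at hr5
    obtain ⟨t, ht, r', hst, h1, h2, h3, h4⟩ := ih
      (Function.update (Function.update (Function.update (Function.update r 6 a) (r 3) a) 3
        (r 3 + 1)) 5 x.length)
      (by simp [Function.update_apply, hr1]; omega) (by simp [Function.update_apply, hr2]; omega)
      (by simp; omega) (by simp)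
    have h33 : (3 : ℕ) ≠ r 3 := by omega
    have h13' : (1 : ℕ) ≠ r 3 := by omega
    have h53 : (5 : ℕ) ≠ r 3 := by omega
    refine ⟨t + 1 + 1 + 1 + 1 + 1 + 1, by rw [List.length_cons]; omega, r',
      steps_cons h9 ?_, h1, h2, fun i hi hi3 => ?_, fun i hi => ?_⟩
    · simp only [Instr.exec]
      rw [if_neg (by omega)]
      refine steps_cons h10 (steps_cons h11 (steps_cons h12 (steps_cons h13 (steps_cons h14 ?_))))
      simpa [Instr.exec, Function.update_apply, h33, h13', h53, hr1, hr5] using hst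
    · rw [h3 i hi (by simp; omega)]
      simp only [Function.update_apply]
      split_ifs <;> omega
    · have hr' : ∀ y, Function.update (Function.update (Function.update (Function.update r 6 a)
        (r 3) a) 3 (r 3 + 1)) 5 y 3 = r 3 + 1 := fun y => by simp
      rw [hr'] at h3 h4
      cases i with
      | zero =>
        rw [Nat.add_zero, h3 _ hr3 (by omega)]
        simp only [Function.update_apply, List.getElem_cons_zero]
        split_ifs <;> omega
      | succ i =>
        have := h4 i (by simpa using hi)
        rw [show r 3 + (i + 1) = r 3 + 1 + i by omega, this]
        simp

theorem getElem?_flatMap_of_length_eq {α β : Type*} (f : α → List β) (n : ℕ) (l : List α)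
    (hf : ∀ a ∈ l, (f a).length = n) (i j : ℕ) (hi : i < l.length) (hj : j < n) :
    (l.flatMap f)[n * i + j]? = (f l[i])[j]? := by
  induction l generalizing i with
  | nil => simp at hi
  | cons a l ih =>
    have ha := hf a (by simp)
    rw [List.flatMap_cons]
    cases i with
    | zero => rw [List.getElem?_append_left (by simp [ha, hj])]; simp
    | succ i =>
      rw [List.getElem?_append_right (by rw [ha, Nat.mul_succ]; omega), ha,
        show n * (i + 1) + j - n = n * i + j by rw [Nat.mul_succ]; omega,
        ih (fun b hb => hf b (by simp [hb])) i (by simpa using hi)]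
      simp

open Classical in
/-- The rows of the adjacency matrix. -/
noncomputable def matrixEntries {n : ℕ} (G : SimpleGraph (Fin n)) : List ℕ :=
  (List.finRange n).flatMap fun u => (List.finRange n).map fun v => if G.Adj u v then 1 else 0

theorem length_matrixEntries {n : ℕ} (G : SimpleGraph (Fin n)) :
    (matrixEntries G).length = n * n := by
  simp [matrixEntries, List.length_flatMap]

open Classical in
theorem getElem?_matrixEntries {n : ℕ} (G : SimpleGraph (Fin n)) (u v : Fin n) :
    (matrixEntries G)[n * u + v]? = some (if G.Adj u v then 1 else 0) := by
  rw [matrixEntries, getElem?_flatMap_of_length_eq _ n _ (by simp) _ _ (by simp) v.2]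
  simp

theorem exists_steps_load {P : Program} {B l n : ℕ} (hP : CodeAt P 0 (loadCode B l)) (hB : 7 ≤ B)
    (G : SimpleGraph (Fin n)) (e : Fin 0 → Fin n) (hn : n ≠ 0) :
    ∃ t ≤ 6 * (n * n) + 4 * n + 6, ∃ r : ℕ → ℕ,
      steps P t (start (encodeGraph G)) = some ⟨15, r, []⟩ ∧ Represents G B 0 e r := by
  simp only [loadCode, codeAt_cons, Nat.zero_add, Nat.reduceAdd] at hP
  obtain ⟨h0, h1, h2, h3, h4, h5, h6, h7, h8, h9, h10, h11, h12, h13, h14, -⟩ := hP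
  obtain ⟨m, rfl⟩ := Nat.exists_eq_succ_of_ne_zero hn
  -- These are the registers after the first five instructions; `.add 4 2 0` copies n because
  -- register 0 still holds 0.
  obtain ⟨t, ht, r, hst, hr1, hr2, hr3, hr5⟩ := multiply_loop h5 h6 h7 h8 (matrixEntries G) (m + 1) m
    (Function.update (Function.update (Function.update (Function.update (fun _ => 0) 2 (m + 1)) 1 1)
      3 B) 4 (m + 1)) (by simp) (by simp) (by simp)
  have hr3' : r 3 = B := by simpa using hr3
  obtain ⟨t', ht', r', hst', hr1', hr2', -, hr4'⟩ := copy_loop h9 h10 h11 h12 h13 h14 (m + 1)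
    (matrixEntries G) r hr1 hr2 (by omega) (by rw [hr5, length_matrixEntries]; simp)
  rw [length_matrixEntries] at ht'
  have hent : ∀ u v : Fin (m + 1), some (r' (B + (m + 1) * u + v)) =
      (matrixEntries G)[(m + 1) * (u : ℕ) + v]? := by
    intro u v
    have hlt : (m + 1) * (u : ℕ) + v < (m + 1) * (m + 1) := by
      have : (m + 1) * ((u : ℕ) + 1) ≤ (m + 1) * (m + 1) := Nat.mul_le_mul_left _ u.2
      rw [Nat.mul_succ] at this
      omega
    rw [add_assoc, ← hr3', hr4' _ (by rwa [length_matrixEntries]), List.getElem?_eq_getElem]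
  refine ⟨t + 1 + 1 + 1 + 1 + 1 + t', by simp only [Nat.succ_eq_add_one] at *; omega, r',
    steps_trans (steps_cons h0 (steps_cons h1 ?_)) hst', hr1', hr2', fun i => i.elim0,
    fun i => i.elim0, fun u v huv => ?_, fun u v huv => ?_⟩
  · simp only [Instr.exec]
    rw [if_neg (by simp [encodeGraph])]
    refine steps_cons h2 (steps_cons h3 (steps_cons h4 ?_))
    simpa [Instr.exec, encodeGraph, matrixEntries] using hst
  · have := hent u v
    rwa [getElem?_matrixEntries, if_pos huv, Option.some_inj] at this
  · have := hent u v
    rwa [getElem?_matrixEntries, if_neg huv, Option.some_inj] at this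

/-! ### From first-order definability to polynomial time -/

/-- A property of graphs without the empty graph that is first-order definable on a class of graphs
can be decided in polynomial time on this class. -/
theorem polyTimeSolvableOn_of_formula {C Q : ∀ {n : ℕ}, SimpleGraph (Fin n) → Prop}
    (φ : Formula 0) (h0 : ∀ G : SimpleGraph (Fin 0), ¬ Q G)
    (h : ∀ {n : ℕ} (G : SimpleGraph (Fin n)), C G → (Q G ↔ φ.Sat G Fin.elim0)) :
    PolyTimeSolvableOn C Q := by
  -- The first register beyond those of the nested variables.
  set B := 7 + 2 * φ.depth with hB
  set P := loadCode B (15 + φ.codeLength) ++ φ.compile B 15 with hPdef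
  have hlen : P.length = 15 + φ.codeLength := by
    simp [hPdef, Formula.length_compile, loadCode]
    omega
  have hhalt : P[15 + φ.codeLength]? = none := by
    rw [List.getElem?_eq_none_iff, hlen]
  have hload : CodeAt P 0 (loadCode B (15 + φ.codeLength)) := codeAt_self _ _
  have hcode : CodeAt P 15 (φ.compile B 15) := by
    have : CodeAt P 0 P := by simpa using codeAt_self P []
    nth_rw 2 [hPdef] at this
    simpa [loadCode] using (codeAt_append.1 this).2
  refine ⟨P, 6 * (.X * .X) + 4 * .X + 6 + φ.time, fun n G hG => ?_⟩
  -- Without vertices the program jumps straight to its end with 0 in register 0, which is right by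
  -- `h0`.
  rcases Nat.eq_zero_or_pos n with rfl | hn
  · simp only [loadCode, codeAt_cons, Nat.zero_add] at hload
    refine ⟨2, ?_, _, steps_cons hload.1 (steps_one hload.2.1), ?_, fun hq => absurd hq (h0 G),
      fun _ => ?_⟩
    · simp; omega
    · simp [step, Instr.exec, encodeGraph, hhalt]
    · simp [Instr.exec]
  · obtain ⟨t, ht, r, hst, hrep⟩ := exists_steps_load hload (by omega) G Fin.elim0 hn.ne'
    obtain ⟨t', ht', r', hst', -, hres⟩ :=
      φ.evaluates_compile Fin.elim0 15 hcode (by omega) r hrep []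
    refine ⟨t + t', ?_, _, steps_trans hst hst', by simp [step, hhalt], fun hq => ?_, fun hq => ?_⟩
    · simp only [Polynomial.eval_add, Polynomial.eval_mul, Polynomial.eval_X,
        Polynomial.eval_ofNat]
      omega
    · simpa [(h G hG).1 hq] using hres
    · simpa [mt (h G hG).2 hq] using hres

end RAM

/-! ### Matching-cuts as colour classes -/

namespace MatchingCut

variable {V : Type*} {G : SimpleGraph V}

/-- Every vertex has at most one neighbour on the other side of `S`. -/
def IsMatchingSide (G : SimpleGraph V) (S : Set V) : Prop :=
  ∀ v w z, G.Adj v w → G.Adj v z → ¬ (v ∈ S ↔ w ∈ S) → ¬ (v ∈ S ↔ z ∈ S) → w = z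

/-- Some edge of `G` leaves `S`. -/
def Crosses (G : SimpleGraph V) (S : Set V) : Prop :=
  ∃ u v, G.Adj u v ∧ u ∈ S ∧ v ∉ S

theorem mem_of_reachable {S : Set V} (h : ∀ u v, G.Adj u v → u ∈ S → v ∈ S) {u v : V}
    (huv : G.Reachable u v) (hu : u ∈ S) : v ∈ S := by
  obtain ⟨p⟩ := huv
  induction p with
  | nil => exact hu
  | cons hadj _ ih => exact ih (h _ _ hadj hu)

/-- Given a cut E, take for S the vertices reachable from u in G - E: every edge across S belongs to
E. Given S, the edges across S form the cut. -/
theorem hasMatchingCut_iff_exists_side :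
    HasMatchingCut G ↔ ∃ S : Set V, IsMatchingSide G S ∧ (∃ u, u ∈ S) ∧ ∃ v, v ∉ S := by
  constructor
  · rintro ⟨E, ⟨hE, hcut⟩, hmatch⟩
    simp only [SimpleGraph.Preconnected, not_forall] at hcut
    obtain ⟨u, v, huv⟩ := hcut
    have key : ∀ y z, G.Adj y z → ¬ ((G.deleteEdges E).Reachable u y ↔
        (G.deleteEdges E).Reachable u z) → s(y, z) ∈ E := by
      intro y z hyz hne
      by_contra hnot
      have hadj : (G.deleteEdges E).Adj y z := SimpleGraph.deleteEdges_adj.2 ⟨hyz, hnot⟩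
      exact hne ⟨fun h => h.trans hadj.reachable, fun h => h.trans hadj.symm.reachable⟩
    refine ⟨{w | (G.deleteEdges E).Reachable u w}, fun y w z hw hz hyw hyz => ?_,
      ⟨u, SimpleGraph.Reachable.refl u⟩, v, huv⟩
    by_contra hne
    refine hmatch _ (key y w hw hyw) _ (key y z hz hyz) (fun h => ?_) y (by simp) (by simp)
    simp only [Sym2.eq_iff] at h
    rcases h with ⟨-, h⟩ | ⟨h, h'⟩
    · exact hne h
    · exact hne (h'.trans h)
  · rintro ⟨S, hS, ⟨u, hu⟩, v, hv⟩
    refine ⟨{f | ∃ y z, G.Adj y z ∧ y ∈ S ∧ z ∉ S ∧ f = s(y, z)}, ⟨?_, fun h => ?_⟩, ?_⟩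
    · rintro _ ⟨y, z, h, -, -, rfl⟩
      exact h
    · refine hv (mem_of_reachable (G := G.deleteEdges _) (fun y z hyz hy => ?_) (h u v) hu)
      by_contra hz
      rw [SimpleGraph.deleteEdges_adj] at hyz
      exact hyz.2 ⟨y, z, hyz.1, hy, hz, rfl⟩
    · rintro _ ⟨y, z, h, hy, hz, rfl⟩ _ ⟨y', z', h', hy', hz', rfl⟩ hne x hx hx'
      simp only [Sym2.mem_iff] at hx hx'
      rcases hx with rfl | rfl <;> rcases hx' with rfl | rfl
      · exact hne (by rw [hS x z z' h h' (by tauto) (by tauto)])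
      · exact hz' hy
      · exact hz hy'
      · exact hne (by rw [hS x y y' h.symm h'.symm (by tauto) (by tauto)])

/-- In a connected graph a proper nonempty side is crossed by an edge; in a disconnected graph a
component is a side that no edge leaves. -/
theorem hasMatchingCut_iff :
    HasMatchingCut G ↔ ¬ G.Preconnected ∨ ∃ S : Set V, IsMatchingSide G S ∧ Crosses G S := by
  rw [hasMatchingCut_iff_exists_side]
  constructor
  · rintro ⟨S, hS, ⟨u, hu⟩, v, hv⟩
    refine or_iff_not_imp_left.2 fun h => ⟨S, hS, ?_⟩
    rw [not_not] at h
    by_contra hcross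
    refine hv (mem_of_reachable (fun y z hyz hy => ?_) (h u v) hu)
    by_contra hz
    exact hcross ⟨y, z, hyz, hy, hz⟩
  · rintro (h | ⟨S, hS, u, v, -, hu, hv⟩)
    · simp only [SimpleGraph.Preconnected, not_forall] at h
      obtain ⟨u, v, huv⟩ := h
      refine ⟨{w | G.Reachable u w}, fun y w z hw hz hyw _ => absurd ?_ hyw,
        ⟨u, SimpleGraph.Reachable.refl u⟩, v, huv⟩
      exact ⟨fun h => h.trans hw.reachable, fun h => h.trans hw.symm.reachable⟩
    · exact ⟨S, hS, ⟨u, hu⟩, v, hv⟩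

/-- A side of one component is a side of G, since no edge leaves the component. Conversely, a
crossed side of G restricts to the component of a crossing edge. -/
theorem someComponentHasMatchingCut_iff :
    SomeComponentHasMatchingCut G ↔ ∃ S : Set V, IsMatchingSide G S ∧ Crosses G S := by
  constructor
  · rintro ⟨c, hc⟩
    rw [hasMatchingCut_iff] at hc
    obtain ⟨S, hS, u, v, huv, hu, hv⟩ :=
      hc.resolve_left (not_not.2 c.connected_toSimpleGraph.preconnected)
    have hmem : ∀ y : V, ∀ hy : y ∈ c, y ∈ Subtype.val '' S ↔ (⟨y, hy⟩ : c) ∈ S := by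
      intro y hy
      constructor
      · rintro ⟨y', h, rfl⟩; exact h
      · exact fun h => ⟨_, h, rfl⟩
    have hout : ∀ y, y ∉ c → y ∉ Subtype.val '' S := by
      rintro _ hy ⟨y, -, rfl⟩
      exact hy y.2
    refine ⟨Subtype.val '' S, fun y w z hw hz hyw hyz => ?_, u, v, huv, ⟨u, hu, rfl⟩, ?_⟩
    · have hc : ∀ w, G.Adj y w → (y ∈ c ↔ w ∈ c) := fun w h =>
        SimpleGraph.ConnectedComponent.mem_supp_congr_adj c h
      by_cases hy : y ∈ c
      · have hw' := (hc w hw).1 hy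
        have hz' := (hc z hz).1 hy
        rw [hmem y hy, hmem w hw'] at hyw
        rw [hmem y hy, hmem z hz'] at hyz
        exact congrArg Subtype.val (hS ⟨y, hy⟩ ⟨w, hw'⟩ ⟨z, hz'⟩ hw hz hyw hyz)
      · exact absurd (iff_of_false (hout y hy) (hout w (fun h => hy ((hc w hw).2 h)))) hyw
    · rw [hmem v.1 v.2]
      exact hv
  · rintro ⟨S, hS, u, v, huv, hu, hv⟩
    have hvc : v ∈ G.connectedComponentMk u :=
      (SimpleGraph.ConnectedComponent.mem_supp_congr_adj (G.connectedComponentMk u) huv).1 rfl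
    refine ⟨G.connectedComponentMk u, hasMatchingCut_iff_exists_side.2 ⟨Subtype.val ⁻¹' S,
      fun y w z hw hz hyw hyz => Subtype.ext (hS y w z hw hz hyw hyz), ⟨⟨u, rfl⟩, hu⟩,
      ⟨v, hvc⟩, hv⟩⟩

/-! ### Graphs without induced paths on five vertices -/

theorem PathFree.false_of_path (hG : PathFree 5 G) {a b c d e : V} (hab : G.Adj a b)
    (hbc : G.Adj b c) (hcd : G.Adj c d) (hde : G.Adj d e) (hac : ¬ G.Adj a c) (had : ¬ G.Adj a d)
    (hae : ¬ G.Adj a e) (hbd : ¬ G.Adj b d) (hbe : ¬ G.Adj b e) (hce : ¬ G.Adj c e) : False := by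
  have hadj : ∀ i j : Fin 5, G.Adj (![a, b, c, d, e] i) (![a, b, c, d, e] j) ↔
      (SimpleGraph.pathGraph 5).Adj i j := by
    intro i j
    rw [SimpleGraph.pathGraph_adj]
    fin_cases i <;> fin_cases j <;> simp [G.adj_comm, *]
  refine hG ⟨⟨⟨![a, b, c, d, e], fun i j hij => ?_⟩, hadj _ _⟩⟩
  -- The five vertices need not be assumed distinct: different vertices of this path have different
  -- neighbourhoods.
  have h : ∀ k, (SimpleGraph.pathGraph 5).Adj i k ↔ (SimpleGraph.pathGraph 5).Adj j k := by
    intro k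
    rw [← hadj, ← hadj, hij]
  simp only [SimpleGraph.pathGraph_adj] at h
  clear hij
  revert i j
  decide

/-- `u` and `v` are joined by a walk of length at most `3`. -/
def IsNear (G : SimpleGraph V) (u v : V) : Prop :=
  ∃ p q, (u = p ∨ G.Adj u p) ∧ (p = q ∨ G.Adj p q) ∧ (q = v ∨ G.Adj q v)

/-- The vertices at distance at most 3 from u are closed under adjacency: a vertex at distance 4
would end an induced path on five vertices. -/
theorem PathFree.preconnected_iff (hG : PathFree 5 G) :
    G.Preconnected ↔ ∀ u v, IsNear G u v := by
  constructor
  · intro h u v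
    refine mem_of_reachable (S := {v | IsNear G u v}) ?_ (h u v) ⟨u, u, by simp⟩
    rintro w z hwz ⟨p, q, hup, hpq, hqw⟩
    by_contra hz
    have hz' : ∀ p q, (u = p ∨ G.Adj u p) → (p = q ∨ G.Adj p q) → ¬ (q = z ∨ G.Adj q z) :=
      fun p q h1 h2 h3 => hz ⟨p, q, h1, h2, h3⟩
    rcases hup with rfl | hup
    · exact hz' q w hpq hqw (Or.inr hwz)
    rcases hpq with rfl | hpq
    · exact hz' p w (Or.inr hup) hqw (Or.inr hwz)
    rcases hqw with rfl | hqw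
    · exact hz' p q (Or.inr hup) (Or.inr hpq) (Or.inr hwz)
    exact hG.false_of_path hup hpq hqw hwz
      (fun h => hz' q w (Or.inr h) (Or.inr hqw) (Or.inr hwz))
      (fun h => hz' u w (Or.inl rfl) (Or.inr h) (Or.inr hwz))
      (fun h => hz' u u (Or.inl rfl) (Or.inl rfl) (Or.inr h))
      (fun h => hz' p w (Or.inr hup) (Or.inr h) (Or.inr hwz))
      (fun h => hz' p p (Or.inr hup) (Or.inl rfl) (Or.inr h))
      (fun h => hz' p q (Or.inr hup) (Or.inr hpq) (Or.inr h))
  · rintro h u v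
    obtain ⟨p, q, hup, hpq, hqv⟩ := h u v
    have key : ∀ {a b : V}, a = b ∨ G.Adj a b → G.Reachable a b := by
      rintro a b (rfl | h)
      · exact SimpleGraph.Reachable.refl _
      · exact h.reachable
    exact (key hup).trans ((key hpq).trans (key hqv))

/-- The closed neighbourhood of `d` without `e`, together with `f`. -/
def ballSet (G : SimpleGraph V) (d e f : V) : Set V :=
  {v | v = f ∨ ((v = d ∨ G.Adj d v) ∧ v ≠ e)}

/-- Near a vertex `p`, the side `S` is described by three vertices. -/
theorem IsMatchingSide.exists_ballSet {S : Set V} (hS : IsMatchingSide G S) {a b : V} (ha : a ∉ S)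
    (hb : b ∈ S) (hab : G.Adj a b) (p : V) :
    ∃ d e f, (∀ v ∈ S, v = p ∨ G.Adj p v → v ∈ ballSet G d e f) ∧
      ∀ v ∈ ballSet G d e f, v ∈ S ∧ ((v = p ∨ G.Adj p v) ∨ (v = b ∨ G.Adj b v)) := by
  by_cases hp : p ∈ S
  -- The ball of p, without its only neighbour outside S. If there is none, removing a is harmless
  -- because a ∉ S; adding b ∈ S is harmless anyway.
  · by_cases h : ∃ e, G.Adj p e ∧ e ∉ S
    · obtain ⟨e, hpe, he⟩ := h
      refine ⟨p, e, b, fun v hv hpv => Or.inr ⟨hpv, fun h => he (h ▸ hv)⟩, ?_⟩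
      rintro v (rfl | ⟨rfl | hpv, hve⟩)
      · exact ⟨hb, by simp⟩
      · exact ⟨hp, by simp⟩
      · refine ⟨?_, by simp [hpv]⟩
        by_contra hv
        exact hve (hS p v e hpv hpe (by tauto) (by tauto))
    · refine ⟨p, a, b, fun v hv hpv => Or.inr ⟨hpv, fun h => ha (h ▸ hv)⟩, ?_⟩
      rintro v (rfl | ⟨rfl | hpv, hve⟩)
      · exact ⟨hb, by simp⟩
      · exact ⟨hp, by simp⟩
      · refine ⟨?_, by simp [hpv]⟩
        by_contra hv
        exact h ⟨v, hpv, hv⟩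
  -- Now p has at most one neighbour f in S, and only f has to be covered. The ball of b without a
  -- serves as a filler that lies inside S.
  · have hball : ∀ v, (v = b ∨ G.Adj b v) ∧ v ≠ a → v ∈ S := by
      rintro v ⟨rfl | hbv, hva⟩
      · exact hb
      · by_contra hv
        exact hva (hS b v a hbv hab.symm (by tauto) (by tauto))
    by_cases h : ∃ f, G.Adj p f ∧ f ∈ S
    · obtain ⟨f, hpf, hf⟩ := h
      refine ⟨b, a, f, ?_, ?_⟩
      · rintro v hv (rfl | hpv)
        · exact absurd hv hp
        · exact Or.inl (hS p v f hpv hpf (by tauto) (by tauto))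
      · rintro v (rfl | hv)
        · exact ⟨hf, by simp [hpf]⟩
        · exact ⟨hball v hv, by tauto⟩
    · refine ⟨b, a, b, ?_, ?_⟩
      · rintro v hv (rfl | hpv)
        · exact absurd hv hp
        · exact absurd ⟨v, hpv, hv⟩ h
      · rintro v (rfl | hv)
        · exact ⟨hb, by simp⟩
        · exact ⟨hball v hv, by tauto⟩

/-- The vertices `a`, `b`, `p`, `q` dominate the component that contains them. -/
theorem PathFree.exists_dominating (hG : PathFree 5 G) {S : Set V} (hS : IsMatchingSide G S)
    {a b a₁ b₁ : V} (ha : a ∉ S) (hb : b ∈ S) (hab : G.Adj a b) (ha₁ : G.Adj a a₁) (ha₁b : a₁ ≠ b)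
    (hb₁ : G.Adj b b₁) (hb₁a : b₁ ≠ a) :
    ∃ p q, ∀ y z, G.Adj y z → (∃ d, (d = a ∨ d = b ∨ d = p ∨ d = q) ∧ (y = d ∨ G.Adj d y)) →
      ∃ d, (d = a ∨ d = b ∨ d = p ∨ d = q) ∧ (z = d ∨ G.Adj d z) := by
  have hA : ∀ v, G.Adj a v → v ≠ b → v ∉ S := fun v hv hvb h =>
    hvb (hS a v b hv hab (by tauto) (by tauto))
  have hB : ∀ v, G.Adj b v → v ≠ a → v ∈ S := fun v hv hva => by
    by_contra h
    exact hva (hS b v a hv hab.symm (by tauto) (by tauto))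
  have hAb : ∀ v, G.Adj a v → v ≠ b → ¬ G.Adj b v := fun v hv hvb h =>
    hA v hv hvb (hB v h hv.ne')
  have hBa : ∀ v, G.Adj b v → v ≠ a → ¬ G.Adj a v := fun v hv hva h =>
    hA v h hv.ne' (hB v hv hva)
  -- a vertex outside that sees `a'` sees every `b'` that `a'` does not see, and conversely
  have hpath : ∀ z a' b', ¬ G.Adj a z → ¬ G.Adj b z → G.Adj a a' → a' ≠ b → G.Adj b b' → b' ≠ a →
      (G.Adj a' z ∨ G.Adj b' z) → ¬ G.Adj a' b' → G.Adj a' z ∧ G.Adj b' z := by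
    intro z a' b' haz hbz ha' ha'b hb' hb'a hz hn
    -- Otherwise z, a', a, b, b', read from whichever end sees z, is an induced path.
    by_contra hnot
    rcases hz with hz | hz
    · exact hG.false_of_path hz.symm ha'.symm hab hb' (fun h => haz h.symm) (fun h => hbz h.symm)
        (fun h => hnot ⟨hz, h.symm⟩) (fun h => hAb a' ha' ha'b h.symm) hn
        (hBa b' hb' hb'a)
    · exact hG.false_of_path hz.symm hb'.symm hab.symm ha' (fun h => hbz h.symm)
        (fun h => haz h.symm) (fun h => hnot ⟨h.symm, hz⟩)
        (fun h => hBa b' hb' hb'a h.symm) (fun h => hn h.symm) (hAb a' ha' ha'b)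
  -- it suffices to dominate the second neighbourhood of the edge
  suffices h : ∃ p q, ((G.Adj a p ∧ p ≠ b) ∨ (G.Adj b p ∧ p ≠ a)) ∧
      ((G.Adj a q ∧ q ≠ b) ∨ (G.Adj b q ∧ q ≠ a)) ∧
      ∀ y z, ((G.Adj a y ∧ y ≠ b) ∨ (G.Adj b y ∧ y ≠ a)) → G.Adj y z → ¬ G.Adj a z →
        ¬ G.Adj b z → G.Adj p z ∨ G.Adj q z by
    obtain ⟨p, q, hp, hq, hdom⟩ := h
    refine ⟨p, q, fun y z hyz ⟨d, hd, hdy⟩ => ?_⟩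
    by_contra hz
    have hz' : ∀ d, (d = a ∨ d = b ∨ d = p ∨ d = q) → ¬ (z = d ∨ G.Adj d z) :=
      fun d hd h => hz ⟨d, hd, h⟩
    have hza := hz' a (by simp)
    have hzb := hz' b (by simp)
    have hzp := hz' p (by simp)
    have hzq := hz' q (by simp)
    rw [not_or] at hza hzb hzp hzq
    have hyab : ∀ c, c = a ∨ c = b → y ≠ c := by
      rintro c (rfl | rfl) rfl
      · exact hza.2 hyz
      · exact hzb.2 hyz
    have hya := hyab a (by simp)
    have hyb := hyab b (by simp)
    have hsec : ¬ ((G.Adj a y ∧ y ≠ b) ∨ (G.Adj b y ∧ y ≠ a)) := by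
      intro hy
      rcases hdom y z hy hyz hza.2 hzb.2 with h | h
      · exact hzp.2 h
      · exact hzq.2 h
    -- A vertex z that escapes through a second neighbour y gives an induced path z, y, d, followed
    -- by the edge ab starting at the end adjacent to d.
    have hfar : ∀ d, (G.Adj a d ∧ d ≠ b) ∨ (G.Adj b d ∧ d ≠ a) → ¬ G.Adj d z → y ≠ d →
        ¬ G.Adj d y := by
      rintro d (⟨had, hdb⟩ | ⟨hbd, hda⟩) hdz hyd hdy
      · exact hG.false_of_path hyz.symm hdy.symm had.symm hab (fun h => hdz h.symm)
          (fun h => hza.2 h.symm) (fun h => hzb.2 h.symm) (fun h => hsec (Or.inl ⟨h.symm, hyb⟩))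
          (fun h => hsec (Or.inr ⟨h.symm, hya⟩)) (fun h => hAb d had hdb h.symm)
      · exact hG.false_of_path hyz.symm hdy.symm hbd.symm hab.symm (fun h => hdz h.symm)
          (fun h => hzb.2 h.symm) (fun h => hza.2 h.symm) (fun h => hsec (Or.inr ⟨h.symm, hya⟩))
          (fun h => hsec (Or.inl ⟨h.symm, hyb⟩)) (fun h => hBa d hbd hda h.symm)
    rcases hd with rfl | rfl | rfl | rfl
    · exact hsec (Or.inl ⟨hdy.resolve_left hya, hyb⟩)
    · exact hsec (Or.inr ⟨hdy.resolve_left hyb, hya⟩)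
    · rcases hdy with rfl | hdy
      · exact hsec hp
      · exact hfar d hp hzp.2 (fun h => hzp.2 (h ▸ hyz)) hdy
    · rcases hdy with rfl | hdy
      · exact hsec hq
      · exact hfar d hq hzq.2 (fun h => hzq.2 (h ▸ hyz)) hdy
  have huniqA : ∀ a' b' b'', a' ∉ S → b' ∈ S → b'' ∈ S → G.Adj a' b' → G.Adj a' b'' → b' = b'' :=
    fun a' b' b'' h h' h'' e e' => hS a' b' b'' e e' (by tauto) (by tauto)
  have huniqB : ∀ b' a' a'', b' ∈ S → a' ∉ S → a'' ∉ S → G.Adj b' a' → G.Adj b' a'' → a' = a'' :=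
    fun b' a' a'' h h' h'' e e' => hS b' a' a'' e e' (by tauto) (by tauto)
  -- Suppose z is seen from the side of b only. Then b' sees every other neighbour of a, but has at
  -- most one neighbour outside S, so a₁ is the only one. Also b' is the only neighbour of a₁ in S,
  -- so by `hpath` a₁ covers whatever the other neighbours of b see.
  by_cases h1 : ∃ z b', ¬ G.Adj a z ∧ ¬ G.Adj b z ∧ G.Adj b b' ∧ b' ≠ a ∧ G.Adj b' z ∧
      ∀ a', G.Adj a a' → a' ≠ b → ¬ G.Adj a' z
  · obtain ⟨z, b', haz, hbz, hb', hb'a, hb'z, hz⟩ := h1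
    have hadj : ∀ a', G.Adj a a' → a' ≠ b → G.Adj a' b' := fun a' ha' ha'b => by
      by_contra hn
      exact hz a' ha' ha'b (hpath z a' b' haz hbz ha' ha'b hb' hb'a (Or.inr hb'z) hn).1
    have hone : ∀ a', G.Adj a a' → a' ≠ b → a' = a₁ := fun a' ha' ha'b =>
      huniqB b' a' a₁ (hB b' hb' hb'a) (hA a' ha' ha'b) (hA a₁ ha₁ ha₁b) (hadj a' ha' ha'b).symm
        (hadj a₁ ha₁ ha₁b).symm
    refine ⟨b', a₁, Or.inr ⟨hb', hb'a⟩, Or.inl ⟨ha₁, ha₁b⟩, ?_⟩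
    rintro y w (⟨hay, hyb⟩ | ⟨hby, hya⟩) hyw haw hbw
    · exact Or.inr (hone y hay hyb ▸ hyw)
    · by_contra hw
      rw [not_or] at hw
      have : ¬ G.Adj a₁ y := fun h => hw.1
        (huniqA a₁ y b' (hA a₁ ha₁ ha₁b) (hB y hby hya) (hB b' hb' hb'a) h
          (hadj a₁ ha₁ ha₁b) ▸ hyw)
      exact hw.2 (hpath w a₁ y haw hbw ha₁ ha₁b hby hya (Or.inr hyw) this).1
  by_cases h2 : ∃ z a', ¬ G.Adj a z ∧ ¬ G.Adj b z ∧ G.Adj a a' ∧ a' ≠ b ∧ G.Adj a' z ∧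
      ∀ b', G.Adj b b' → b' ≠ a → ¬ G.Adj b' z
  · obtain ⟨z, a', haz, hbz, ha', ha'b, ha'z, hz⟩ := h2
    have hadj : ∀ b', G.Adj b b' → b' ≠ a → G.Adj a' b' := fun b' hb' hb'a => by
      by_contra hn
      exact hz b' hb' hb'a (hpath z a' b' haz hbz ha' ha'b hb' hb'a (Or.inl ha'z) hn).2
    have hone : ∀ b', G.Adj b b' → b' ≠ a → b' = b₁ := fun b' hb' hb'a =>
      huniqA a' b' b₁ (hA a' ha' ha'b) (hB b' hb' hb'a) (hB b₁ hb₁ hb₁a) (hadj b' hb' hb'a)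
        (hadj b₁ hb₁ hb₁a)
    refine ⟨a', b₁, Or.inl ⟨ha', ha'b⟩, Or.inr ⟨hb₁, hb₁a⟩, ?_⟩
    rintro y w (⟨hay, hyb⟩ | ⟨hby, hya⟩) hyw haw hbw
    · by_contra hw
      rw [not_or] at hw
      have : ¬ G.Adj y b₁ := fun h => hw.1
        (huniqB b₁ y a' (hB b₁ hb₁ hb₁a) (hA y hay hyb) (hA a' ha' ha'b) h.symm
          (hadj b₁ hb₁ hb₁a).symm ▸ hyw)
      exact hw.2 (hpath w y b₁ haw hbw hay hyb hb₁ hb₁a (Or.inl hyw) this).2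
    · exact Or.inr (hone y hby hya ▸ hyw)
  -- From here on, every vertex of the second neighbourhood is seen from both sides.
  push Not at h1 h2
  have hboth : ∀ y z, ((G.Adj a y ∧ y ≠ b) ∨ (G.Adj b y ∧ y ≠ a)) → G.Adj y z → ¬ G.Adj a z →
      ¬ G.Adj b z → (∃ a', G.Adj a a' ∧ a' ≠ b ∧ G.Adj a' z) ∧
        ∃ b', G.Adj b b' ∧ b' ≠ a ∧ G.Adj b' z := by
    rintro y z (⟨hay, hyb⟩ | ⟨hby, hya⟩) hyz haz hbz
    · exact ⟨⟨y, hay, hyb, hyz⟩, h2 z y haz hbz hay hyb hyz⟩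
    · exact ⟨h1 z y haz hbz hby hya hyz, ⟨y, hby, hya, hyz⟩⟩
  by_cases h3 : ∃ b₂, G.Adj b b₂ ∧ b₂ ≠ a ∧ b₂ ≠ b₁
  · obtain ⟨b₂, hb₂, hb₂a, hne⟩ := h3
    refine ⟨b₁, b₂, Or.inr ⟨hb₁, hb₁a⟩, Or.inr ⟨hb₂, hb₂a⟩, fun y z hy hyz haz hbz => ?_⟩
    obtain ⟨⟨a', ha', ha'b, ha'z⟩, -⟩ := hboth y z hy hyz haz hbz
    by_contra hnot
    rw [not_or] at hnot
    -- If both b₁ and b₂ miss z, then a', which sees z, is adjacent to both of them and has two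
    -- neighbours in S.
    have hadj : ∀ b', G.Adj b b' → b' ≠ a → ¬ G.Adj b' z → G.Adj a' b' := fun b' hb' hb'a hn => by
      by_contra hn'
      exact hn (hpath z a' b' haz hbz ha' ha'b hb' hb'a (Or.inl ha'z) hn').2
    exact hne (huniqA a' b₂ b₁ (hA a' ha' ha'b) (hB b₂ hb₂ hb₂a) (hB b₁ hb₁ hb₁a)
      (hadj b₂ hb₂ hb₂a hnot.2) (hadj b₁ hb₁ hb₁a hnot.1))
  · push Not at h3
    refine ⟨b₁, b₁, Or.inr ⟨hb₁, hb₁a⟩, Or.inr ⟨hb₁, hb₁a⟩, fun y z hy hyz haz hbz => ?_⟩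
    obtain ⟨-, b', hb', hb'a, hb'z⟩ := hboth y z hy hyz haz hbz
    exact Or.inl (h3 b' hb' hb'a ▸ hb'z)

/-! ### Three balls suffice -/

/-- The union of three sets of the form `ballSet G d e f`. -/
def threeBalls (G : SimpleGraph V) (g : Fin 9 → V) : Set V :=
  {v | v ∈ ballSet G (g 0) (g 1) (g 2) ∨ v ∈ ballSet G (g 3) (g 4) (g 5) ∨
    v ∈ ballSet G (g 6) (g 7) (g 8)}

/-- The leaf b alone is a side, and it is the ball of b without a, taken three times. -/
theorem exists_threeBalls_of_leaf {a b : V} (hab : G.Adj a b) (hb : ∀ v, G.Adj b v → v = a) :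
    ∃ g : Fin 9 → V, IsMatchingSide G (threeBalls G g) ∧ Crosses G (threeBalls G g) := by
  have hball : ∀ v, v ∈ ballSet G b a b ↔ v = b := by
    intro v
    constructor
    · rintro (h | ⟨h | h, hva⟩)
      · exact h
      · exact h
      · exact absurd (hb v h) hva
    · exact fun h => Or.inl h
  have hmem : ∀ v, v ∈ threeBalls G ![b, a, b, b, a, b, b, a, b] ↔ v = b := by
    intro v
    change v ∈ ballSet G b a b ∨ v ∈ ballSet G b a b ∨ v ∈ ballSet G b a b ↔ v = b
    rw [hball, or_self, or_self]
  refine ⟨![b, a, b, b, a, b, b, a, b], fun v w z hw hz hvw hvz => ?_, b, a, hab.symm,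
    (hmem b).2 rfl, fun h => hab.ne ((hmem a).1 h)⟩
  rw [hmem, hmem] at hvw hvz
  by_cases hvb : v = b
  · subst hvb
    rw [hb w hw, hb z hz]
  · have hw' : w = b := by tauto
    have hz' : z = b := by tauto
    rw [hw', hz']

/-- The dominated set D is closed under adjacency, so S ∩ D is again a side. The balls chosen for b,
p and q make up S ∩ D; none is needed for a, whose only neighbour in S is b. -/
theorem PathFree.exists_threeBalls (hG : PathFree 5 G) {S : Set V} (hS : IsMatchingSide G S)
    (hc : Crosses G S) :
    ∃ g : Fin 9 → V, IsMatchingSide G (threeBalls G g) ∧ Crosses G (threeBalls G g) := by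
  obtain ⟨b, a, hba, hb, ha⟩ := hc
  by_cases hA : ∀ v, G.Adj a v → v = b
  · exact exists_threeBalls_of_leaf hba hA
  by_cases hB : ∀ v, G.Adj b v → v = a
  · exact exists_threeBalls_of_leaf hba.symm hB
  push Not at hA hB
  obtain ⟨a₁, ha₁, ha₁b⟩ := hA
  obtain ⟨b₁, hb₁, hb₁a⟩ := hB
  obtain ⟨p, q, hclosed⟩ := hG.exists_dominating hS ha hb hba.symm ha₁ ha₁b hb₁ hb₁a
  obtain ⟨d₁, e₁, f₁, hd₁, hd₁'⟩ := hS.exists_ballSet ha hb hba.symm b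
  obtain ⟨d₂, e₂, f₂, hd₂, hd₂'⟩ := hS.exists_ballSet ha hb hba.symm p
  obtain ⟨d₃, e₃, f₃, hd₃, hd₃'⟩ := hS.exists_ballSet ha hb hba.symm q
  set D : Set V := {y | ∃ d, (d = a ∨ d = b ∨ d = p ∨ d = q) ∧ (y = d ∨ G.Adj d y)} with hD
  have hclosed' : ∀ y z, G.Adj y z → (y ∈ D ↔ z ∈ D) := fun y z h =>
    ⟨hclosed y z h, hclosed z y h.symm⟩
  have hmem : ∀ v, v ∈ threeBalls G ![d₁, e₁, f₁, d₂, e₂, f₂, d₃, e₃, f₃] ↔ v ∈ S ∧ v ∈ D := by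
    intro v
    change v ∈ ballSet G d₁ e₁ f₁ ∨ v ∈ ballSet G d₂ e₂ f₂ ∨ v ∈ ballSet G d₃ e₃ f₃ ↔ _
    constructor
    · rintro (h | h | h)
      · obtain ⟨h, h'⟩ := hd₁' v h
        exact ⟨h, b, by simp, by tauto⟩
      · obtain ⟨h, h' | h'⟩ := hd₂' v h
        · exact ⟨h, p, by simp, h'⟩
        · exact ⟨h, b, by simp, h'⟩
      · obtain ⟨h, h' | h'⟩ := hd₃' v h
        · exact ⟨h, q, by simp, h'⟩
        · exact ⟨h, b, by simp, h'⟩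
    · rintro ⟨hv, d, rfl | rfl | rfl | rfl, h⟩
      · rcases h with rfl | h
        · exact absurd hv ha
        · have : v = b := hS d v b h hba.symm (by tauto) (by tauto)
          exact Or.inl (hd₁ v hv (Or.inl this))
      · exact Or.inl (hd₁ v hv h)
      · exact Or.inr (Or.inl (hd₂ v hv h))
      · exact Or.inr (Or.inr (hd₃ v hv h))
  refine ⟨![d₁, e₁, f₁, d₂, e₂, f₂, d₃, e₃, f₃], fun v w z hw hz hvw hvz => ?_, b, a, hba,
    (hmem b).2 ⟨hb, b, by simp, by simp⟩, fun h => ha ((hmem a).1 h).1⟩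
  rw [hmem, hmem] at hvw hvz
  have h1 := hclosed' v w hw
  have h2 := hclosed' v z hz
  exact hS v w z hw hz (by tauto) (by tauto)

end MatchingCut

/-! ### The formulas -/

namespace RAM.Formula

variable {V : Type*} {G : SimpleGraph V} {k : ℕ}

/-- Disjunction. -/
def or (φ ψ : Formula k) : Formula k := neg (and (neg φ) (neg ψ))

/-- Equivalence. -/
def iff (φ ψ : Formula k) : Formula k := or (and φ ψ) (and (neg φ) (neg ψ))

/-- The existential quantifier. -/
def ex (φ : Formula (k + 1)) : Formula k := neg (all (neg φ))

/-- The existential closure. -/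
def exs : ∀ k : ℕ, Formula k → Formula 0
  | 0, φ => φ
  | k + 1, φ => exs k (ex φ)

theorem sat_adj (i j : Fin k) (e : Fin k → V) : (adj i j).Sat G e ↔ G.Adj (e i) (e j) := Iff.rfl

theorem sat_eq (i j : Fin k) (e : Fin k → V) : (eq i j).Sat G e ↔ e i = e j := Iff.rfl

theorem sat_neg (φ : Formula k) (e : Fin k → V) : φ.neg.Sat G e ↔ ¬ φ.Sat G e := Iff.rfl

theorem sat_and (φ ψ : Formula k) (e : Fin k → V) :
    (φ.and ψ).Sat G e ↔ φ.Sat G e ∧ ψ.Sat G e := Iff.rfl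

theorem sat_all (φ : Formula (k + 1)) (e : Fin k → V) :
    φ.all.Sat G e ↔ ∀ v, φ.Sat G (Fin.snoc (α := fun _ : Fin (k + 1) => V) e v) := Iff.rfl

theorem sat_or (φ ψ : Formula k) (e : Fin k → V) :
    (φ.or ψ).Sat G e ↔ φ.Sat G e ∨ ψ.Sat G e := by
  simp only [or, sat_neg, sat_and]
  tauto

theorem sat_iff (φ ψ : Formula k) (e : Fin k → V) :
    (φ.iff ψ).Sat G e ↔ (φ.Sat G e ↔ ψ.Sat G e) := by
  simp only [iff, sat_or, sat_neg, sat_and]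
  tauto

theorem sat_ex (φ : Formula (k + 1)) (e : Fin k → V) :
    φ.ex.Sat G e ↔ ∃ v, φ.Sat G (Fin.snoc (α := fun _ : Fin (k + 1) => V) e v) := by
  simp only [ex, sat_neg, sat_all, not_forall, not_not]

theorem sat_exs (φ : Formula k) :
    (exs k φ).Sat G Fin.elim0 ↔ ∃ e : Fin k → V, φ.Sat G e := by
  induction k with
  | zero => exact ⟨fun h => ⟨_, h⟩, fun ⟨e, h⟩ => by rwa [Subsingleton.elim Fin.elim0 e]⟩
  | succ k ih =>
    simp only [exs, ih, sat_ex]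
    constructor
    · rintro ⟨e, v, h⟩
      exact ⟨_, h⟩
    · rintro ⟨e, h⟩
      exact ⟨Fin.init e, e (Fin.last k), by rwa [Fin.snoc_init_self]⟩

end RAM.Formula

namespace MatchingCut

open RAM Formula

variable {V : Type*} {G : SimpleGraph V} {k : ℕ}

/-- `v ∈ ballSet G d e f` -/
def ballFormula (d e f v : Fin k) : Formula k :=
  .or (.eq v f) (.and (.or (.eq v d) (.adj d v)) (.neg (.eq v e)))

/-- `v ∈ threeBalls G g`, where `i` gives the variables for `g`. -/
def threeBallsFormula (i : Fin 9 → Fin k) (v : Fin k) : Formula k :=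
  .or (ballFormula (i 0) (i 1) (i 2) v)
    (.or (ballFormula (i 3) (i 4) (i 5) v) (ballFormula (i 6) (i 7) (i 8) v))

theorem sat_threeBallsFormula (i : Fin 9 → Fin k) (v : Fin k) (e : Fin k → V) :
    (threeBallsFormula i v).Sat G e ↔ e v ∈ threeBalls G (fun j => e (i j)) := by
  simp only [threeBallsFormula, ballFormula, sat_or, sat_and, sat_neg, sat_eq, sat_adj, threeBalls,
    ballSet, Set.mem_ofPred_eq, ne_eq]

/-- Some union of three balls is a matching side. -/
def sideFormula : Formula 0 :=
  -- Variables 0 to 8 are the parameters of the balls; 9, 10, 11 are the vertices v, w, z of the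
  -- side condition, and then 9, 10 the ends of a crossing edge.
  exs 9 (.and
    (.all (.all (.all
      (let S := threeBallsFormula (k := 12) (Fin.castAdd 3)
       .or (.neg (.adj 9 10)) (.or (.neg (.adj 9 11)) (.or (.iff (S 9) (S 10))
        (.or (.iff (S 9) (S 11)) (.eq 10 11))))))))
    (.ex (.ex
      (let S := threeBallsFormula (k := 11) (Fin.castAdd 2)
       .and (.adj 9 10) (.and (S 9) (.neg (S 10)))))))

theorem sat_sideFormula : sideFormula.Sat G Fin.elim0 ↔
    ∃ g : Fin 9 → V, IsMatchingSide G (threeBalls G g) ∧ Crosses G (threeBalls G g) := by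
  rw [sideFormula, sat_exs]
  refine exists_congr fun g => ?_
  simp only [sat_and, sat_all, sat_ex, sat_or, sat_iff, sat_neg, sat_adj, sat_eq,
    sat_threeBallsFormula]
  refine and_congr ?_ ?_
  · refine forall_congr' fun v => forall_congr' fun w => forall_congr' fun z => ?_
    change (¬ G.Adj v w ∨ ¬ G.Adj v z ∨ (v ∈ threeBalls G g ↔ w ∈ threeBalls G g) ∨
      (v ∈ threeBalls G g ↔ z ∈ threeBalls G g) ∨ w = z) ↔ _
    tauto
  · exact Iff.rfl

/-- Some two vertices are not joined by a walk of length at most `3`. -/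
def farFormula : Formula 0 :=
  -- Variables 0 and 1 are the ends of the walk, 2 and 3 its inner vertices.
  exs 2 (.neg (.ex (.ex (.and (.or (.eq 0 2) (.adj 0 2))
    (.and (.or (.eq 2 3) (.adj 2 3)) (.or (.eq 3 1) (.adj 3 1)))))))

theorem sat_farFormula : farFormula.Sat G Fin.elim0 ↔ ¬ ∀ u v, IsNear G u v := by
  rw [farFormula, sat_exs]
  simp only [sat_and, sat_ex, sat_or, sat_neg, sat_adj, sat_eq, not_forall]
  constructor
  · rintro ⟨e, h⟩
    exact ⟨e 0, e 1, h⟩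
  · rintro ⟨u, v, h⟩
    exact ⟨![u, v], h⟩

/-- Only the passage from an arbitrary side to three balls uses P₅-freeness; the converse holds
because the sentence itself checks that the union is a crossed side. -/
theorem PathFree.someComponentHasMatchingCut_iff_sat (hG : PathFree 5 G) :
    SomeComponentHasMatchingCut G ↔ sideFormula.Sat G Fin.elim0 := by
  rw [someComponentHasMatchingCut_iff, sat_sideFormula]
  exact ⟨fun ⟨_, hS, hc⟩ => hG.exists_threeBalls hS hc, fun ⟨g, hg⟩ => ⟨_, hg⟩⟩

theorem PathFree.hasMatchingCut_iff_sat (hG : PathFree 5 G) :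
    HasMatchingCut G ↔ (farFormula.or sideFormula).Sat G Fin.elim0 := by
  rw [hasMatchingCut_iff, sat_or, sat_farFormula, hG.preconnected_iff,
    ← hG.someComponentHasMatchingCut_iff_sat, someComponentHasMatchingCut_iff]

end MatchingCut

/-- On `P₅`-free graphs it can be decided in polynomial time whether the graph has a matching-cut,
and also, for disconnected graphs, whether one of its components has a matching-cut. -/
theorem theorem1 :
    RAM.PolyTimeSolvableOn
        (fun G => MatchingCut.PathFree 5 G)
        (fun G => MatchingCut.HasMatchingCut G) ∧
      RAM.PolyTimeSolvableOn
        (fun G => MatchingCut.PathFree 5 G)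
        (fun G => MatchingCut.SomeComponentHasMatchingCut G) := by
  constructor
  · refine RAM.polyTimeSolvableOn_of_formula _ (fun G hG => ?_)
      fun G hG => hG.hasMatchingCut_iff_sat
    obtain ⟨S, -, ⟨u, -⟩, -⟩ := MatchingCut.hasMatchingCut_iff_exists_side.1 hG
    exact u.elim0
  · refine RAM.polyTimeSolvableOn_of_formula _ (fun G hG => ?_)
      fun G hG => hG.someComponentHasMatchingCut_iff_sat
    obtain ⟨S, -, u, -⟩ := MatchingCut.someComponentHasMatchingCut_iff.1 hG
    exact u.elim0
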